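/- Let $M,N\ge 0$ be integers with $M+N\ge 1$, and let $X_1,\dots,X_M,Y_1,\dots,Y_N$ be independent random variables with $X_i\sim N(0,\sigma_{X_i}^2)$ and $Y_j\sim N(0,\sigma_{Y_j}^2)$, where $\sigma_{X_i},\sigma_{Y_j}>0$. Put $\sigma_M=\prod_{i=1}^M\sigma_{X_i}$, $s_N=\prod_{j=1}^N\sigma_{Y_j}$, $X=\prod_{i=1}^M X_i$, $Y=\prod_{j=1}^N Y_j$ (empty products are $1$), $Z=X/Y$, $F_Z(z)=\mathbb P(Z\le z)$ and $$\kappa=\frac{2^N s_N^2}{2^M\sigma_M^2}.$$ For $x>0$ let $$G^{m,n}_{p,q}\bigg(x\,\bigg|\,{a_1,\dots,a_p\atop b_1,\dots,b_q}\bigg)=\frac1{2\pi\mathrm i}\int_L\frac{\prod_{j=1}^m\Gamma(b_j-s)\prod_{j=1}^n\Gamma(1-a_j+s)}{\prod_{j=n+1}^p\Gamma(a_j-s)\prod_{j=m+1}^q\Gamma(1-b_j+s)}\,x^s\,\mathrm ds$$ be the Meijer $G$-function, where $L$ is a vertical line $\operatorname{Re}s=c$, run through upwards, that has the poles of the factors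 $\Gamma(b_j-s)$, $1\le j\le m$, on its right and those of the factors $\Gamma(1-a_j+s)$, $1\le j\le n$, on its left. For the two $G$-functions below and $x>0$ such lines exist, the integral converges absolutely over each of them, and its value does not depend on the line. For every $z\in\mathbb R$, $$F_Z(z)=\frac12+\frac{2^{(N-M-2)/2}s_N}{\pi^{(M+N)/2}\sigma_M}\,z\,G^{M,N+1}_{N+1,M+1}\bigg(\kappa z^2\,\bigg|\,{\frac12,0,\dots,0\atop 0,\dots,0,-\frac12}\bigg)$$ and $$F_Z(z)=\frac12+\frac{\operatorname{sgn}(z)}{2\pi^{(M+N)/2}}\,G^{M,N+1}_{N+1,M+1}\bigg(\kappa z^2\,\bigg|\,{1,\frac12,\dots,\frac12\atop \frac12,\dots,\frac12,0}\bigg),$$ where the upper rows have $N$ and the lower rows $M$ repeated entries, $\operatorname{sgn}(z)=-1,0,1$ for $z<0$, $z=0$, $z>0$, and at $z=0$ the second summand in each formula is read as $0$. -/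

import Mathlib

open MeasureTheory ProbabilityTheory

/-- The integrand `∏_{j≤m} Γ(b_j - s) ∏_{j≤n} Γ(1 - a_j + s) x^s /
(∏_{j>n} Γ(a_j - s) ∏_{j>m} Γ(1 - b_j + s))` of the Meijer `G`-function `G^{m,n}_{p,q}(x | a; b)`.
`Complex.Gamma` is `0` at its poles, so the reciprocal Gamma factors have their correct
value `0` there. -/
noncomputable def meijerIntegrand (m n : ℕ) {p q : ℕ} (a : Fin p → ℂ) (b : Fin q → ℂ)
    (x : ℝ) (s : ℂ) : ℂ :=
  ((∏ j ∈ Finset.univ.filter (fun j : Fin q => (j : ℕ) < m), Complex.Gamma (b j - s)) *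
      ∏ j ∈ Finset.univ.filter (fun j : Fin p => (j : ℕ) < n), Complex.Gamma (1 - a j + s)) /
    ((∏ j ∈ Finset.univ.filter (fun j : Fin p => n ≤ (j : ℕ)), Complex.Gamma (a j - s)) *
      ∏ j ∈ Finset.univ.filter (fun j : Fin q => m ≤ (j : ℕ)), Complex.Gamma (1 - b j + s)) * (x : ℂ) ^ s

/-- The vertical line `Re s = c` separates the poles `b_j + k` (`j ≤ m`, `k ≥ 0`) of the factors
`Γ(b_j - s)`, on its right, from the poles `a_j - 1 - k` (`j ≤ n`, `k ≥ 0`) of the factors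
`Γ(1 - a_j + s)`, on its left. -/
def IsMeijerLine (m n : ℕ) {p q : ℕ} (a : Fin p → ℂ) (b : Fin q → ℂ) (c : ℝ) : Prop :=
  (∀ j : Fin q, (j : ℕ) < m → ∀ k : ℕ, c < (b j + k).re) ∧
    ∀ j : Fin p, (j : ℕ) < n → ∀ k : ℕ, (a j - 1 - k).re < c

/-- `(2πi)⁻¹ ∫_L` of the integrand, `L` the line `Re s = c` run through from `c - i∞` to `c + i∞`,
parametrized by `s = c + i t`, `ds = i dt`. -/
noncomputable def meijerLineIntegral (m n : ℕ) {p q : ℕ} (a : Fin p → ℂ) (b : Fin q → ℂ)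
    (x : ℝ) (c : ℝ) : ℂ :=
  1 / (2 * (Real.pi : ℂ) * Complex.I) *
    ∫ t : ℝ, meijerIntegrand m n a b x (c + t * Complex.I) * Complex.I

open Classical in
/-- The Meijer `G`-function `G^{m,n}_{p,q}(x | a; b)` as a contour integral, for parameters whose
two families of poles can be separated by a vertical line (value `0` otherwise). That the line
exists, that the integral converges absolutely and that it does not depend on the line chosen is
`MeijerGWellDefined`. -/
noncomputable def meijerG (m n : ℕ) {p q : ℕ} (a : Fin p → ℂ) (b : Fin q → ℂ) (x : ℝ) : ℂ :=
  if h : ∃ c : ℝ, IsMeijerLine m n a b c then meijerLineIntegral m n a b x h.choose else 0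

/-- A separating vertical line exists, and over each such line the contour integral converges
absolutely and has the value `meijerG m n a b x`. -/
def MeijerGWellDefined (m n : ℕ) {p q : ℕ} (a : Fin p → ℂ) (b : Fin q → ℂ) (x : ℝ) : Prop :=
  (∃ c : ℝ, IsMeijerLine m n a b c) ∧
    ∀ c : ℝ, IsMeijerLine m n a b c →
      Integrable (fun t : ℝ => meijerIntegrand m n a b x (c + t * Complex.I)) ∧
        meijerLineIntegral m n a b x c = meijerG m n a b x

/-- The list `u, v, …, v` (`k` copies of `v`). -/
def headThenConst (k : ℕ) (u v : ℂ) : Fin (k + 1) → ℂ :=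
  Fin.cons u fun _ : Fin k => v

/-- The list `v, …, v, u` (`k` copies of `v`). -/
def constThenLast (k : ℕ) (v u : ℂ) : Fin (k + 1) → ℂ :=
  Fin.snoc (α := fun _ => ℂ) (fun _ : Fin k => v) u

/-! `Z` is a product of the independent factors `X_i` and `Y_j⁻¹`, each symmetric and without atoms,
and `M + N ≥ 1`. Hence `Z` is symmetric without atoms, and `F_Z(z) = 1/2 + sgn(z)/2 · P(|Z| ≤ |z|)`
(`measureReal_Iic_eq_of_symm`).

For `z ≠ 0` the event `|Z| ≤ |z|` is, up to a null set, `T ≥ z⁻²` with `T = Z⁻²`. By Fubini the tail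
of `T` has Mellin transform `E[T^s] / s` for `Re s > 0` (`mellin_measureReal_Ici`). Independence and
the Gaussian moments give `E[T^s] = κ^s Γ(1/2 - s)^M Γ(1/2 + s)^N / π^((M+N)/2)`
(`integral_inv_sq_cpow_quotient`), where `Re s < 1/2` is needed only if `M ≠ 0`. Since `1/s =
Γ(s)/Γ(s+1)`, Mellin inversion at `z⁻²` yields exactly the Meijer integral of the second formula
(`measureReal_abs_quotient_le`). The first formula is the same integral after `s ↦ s + 1/2`.

Absolute convergence needs only `|Γ(s)| ≤ Γ(Re s + 1)/|s|`: one Gamma factor and the factor `1/s`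
together decay like `t⁻²`. No contour is moved: the integral over every separating line equals the
same probability up to a constant. -/

/-! ### Complex moments of a centred Gaussian -/

/-- The integral over `ℝ` of a complex-valued even function. -/
theorem integral_comp_abs_complex (f : ℝ → ℂ) :
    ∫ x : ℝ, f |x| = 2 * ∫ x in Set.Ioi (0 : ℝ), f x := by
  have eq : ∫ x in Set.Ioi (0 : ℝ), f |x| = ∫ x in Set.Ioi (0 : ℝ), f x :=
    setIntegral_congr_fun measurableSet_Ioi fun x hx => by
      simp only [abs_of_pos (Set.mem_Ioi.mp hx)]
  by_cases hf : IntegrableOn (fun x => f |x|) (Set.Ioi 0)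
  · have hIic : IntegrableOn (fun x => f |x|) (Set.Iic 0) := by
      rw [← Measure.map_neg_eq_self (volume : Measure ℝ)]
      let m : MeasurableEmbedding fun x : ℝ => -x := (Homeomorph.neg ℝ).measurableEmbedding
      rw [m.integrableOn_map_iff]
      simp_rw [Function.comp_def, abs_neg, Set.neg_preimage, Set.neg_Iic, neg_zero]
      exact Iff.mpr integrableOn_Ici_iff_integrableOn_Ioi hf
    have hsplit : ∫ x, f |x| = (∫ x in Set.Iic 0, f |x|) + ∫ x in Set.Ioi 0, f |x| := by
      rw [← setIntegral_union (Set.Iic_disjoint_Ioi le_rfl) measurableSet_Ioi hIic hf,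
        Set.Iic_union_Ioi, Measure.restrict_univ]
    have hneg : ∫ x in Set.Iic (0 : ℝ), f |x| = ∫ x in Set.Ioi (0 : ℝ), f |x| := by
      have := integral_comp_neg_Iic 0 (fun x => f |x|)
      simpa using this
    rw [hsplit, hneg, eq, two_mul]
  · have : ¬ Integrable (fun x => f |x|) := fun h => hf h.integrableOn
    rw [← eq, integral_undef hf, integral_undef this, mul_zero]

/-- Complex moments of the square of a centred Gaussian variable. -/
theorem integral_sq_cpow_gaussianReal {σ : ℝ} (hσ : 0 < σ) {w : ℂ} (hw : -(1 / 2) < w.re) :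
    ∫ x, ((x ^ 2 : ℝ) : ℂ) ^ w ∂(gaussianReal 0 (σ ^ 2).toNNReal) =
      ((2 * σ ^ 2 : ℝ) : ℂ) ^ w * Complex.Gamma (1 / 2 + w) / (Real.sqrt Real.pi : ℂ) := by
  have hσ2 : 0 < σ ^ 2 := by positivity
  have hv : (σ ^ 2).toNNReal ≠ 0 := by simpa using hσ.ne'
  set A : ℝ := 2 * σ ^ 2 with hA
  have hApos : 0 < A := by positivity
  have hpi : 0 < Real.sqrt Real.pi := Real.sqrt_pos.mpr Real.pi_pos
  rw [integral_gaussianReal_eq_integral_smul hv]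
  -- The substitution `y = x²` turns the Gaussian moment into a Gamma integral with rate `1/A`; the
  -- factor `1/2` offsets the Jacobian `2x`.
  let g : ℝ → ℂ := fun y => ((Real.sqrt A * Real.sqrt Real.pi)⁻¹ / 2 : ℝ) *
    ((y : ℂ) ^ ((1 / 2 + w) - 1) * Complex.exp (-(((1 / A : ℝ) : ℂ) * y)))
  let f : ℝ → ℂ := fun x => gaussianPDFReal 0 (σ ^ 2).toNNReal x • ((x ^ 2 : ℝ) : ℂ) ^ w
  have hfabs : ∀ x, f x = f |x| := by
    intro x
    simp only [f, gaussianPDFReal, sub_zero, sq_abs]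
  have hfg : ∀ x ∈ Set.Ioi (0 : ℝ), f x = ((2 : ℝ) * x ^ ((2 : ℝ) - 1)) • g (x ^ (2 : ℝ)) := by
    intro x hx
    have hx : 0 < x := hx
    have hx0 : (x : ℂ) ≠ 0 := by exact_mod_cast hx.ne'
    have h1 : (((x ^ 2 : ℝ) : ℂ)) ^ w = x * ((x ^ 2 : ℝ) : ℂ) ^ ((1 / 2 + w) - 1) := by
      have : w = 1 / 2 + (1 / 2 + w - 1) := by ring
      nth_rw 1 [this]
      rw [Complex.cpow_add _ _ (by exact_mod_cast (pow_pos hx 2).ne')]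
      congr 1
      rw [show (1 / 2 : ℂ) = ((1 / 2 : ℝ) : ℂ) by push_cast; rfl,
        ← Complex.ofReal_cpow (by positivity), ← Real.sqrt_eq_rpow, Real.sqrt_sq hx.le]
    have h2 : gaussianPDFReal 0 (σ ^ 2).toNNReal x =
        (Real.sqrt A * Real.sqrt Real.pi)⁻¹ * Real.exp (-(1 / A * x ^ 2)) := by
      rw [gaussianPDFReal, ← Real.sqrt_mul hApos.le, Real.coe_toNNReal _ hσ2.le]
      congr 2
      · rw [hA]; ring_nf
      · rw [hA]; ring_nf
    simp only [f, g]
    rw [h1, h2, show (2 : ℝ) - 1 = 1 by norm_num, Real.rpow_one, Real.rpow_two,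
      Complex.real_smul, Complex.real_smul]
    push_cast
    ring
  have hint : ∫ x, f x = 2 * ∫ x in Set.Ioi (0 : ℝ), f x := by
    rw [← integral_comp_abs_complex]
    exact integral_congr_ae (ae_of_all _ hfabs)
  change ∫ x, f x = _
  rw [hint, setIntegral_congr_fun measurableSet_Ioi hfg,
    integral_comp_rpow_Ioi_of_pos (g := g) two_pos]
  simp only [g]
  have hre : 0 < (1 / 2 + w).re := by
    have h12 : ((1 : ℂ) / 2).re = 1 / 2 := by norm_num
    rw [Complex.add_re, h12]
    linarith
  rw [integral_const_mul, Complex.integral_cpow_mul_exp_neg_mul_Ioi hre (by positivity)]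
  have hAA : (1 / ((1 / A : ℝ) : ℂ)) = (A : ℂ) := by push_cast; simp
  have hA0 : (A : ℂ) ≠ 0 := by exact_mod_cast hApos.ne'
  have hsA : (A : ℂ) ^ (1 / 2 : ℂ) = (Real.sqrt A : ℂ) := by
    rw [Real.sqrt_eq_rpow, Complex.ofReal_cpow hApos.le]
    push_cast
    rfl
  rw [hAA, Complex.cpow_add _ _ hA0, hsA]
  have h3 : (Real.sqrt A : ℂ) ≠ 0 := by exact_mod_cast (Real.sqrt_pos.mpr hApos).ne'
  have h4 : (Real.sqrt Real.pi : ℂ) ≠ 0 := by exact_mod_cast hpi.ne'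
  push_cast
  field_simp

/-! ### Decay of the Gamma function on vertical lines -/

/-- On vertical lines in the right half plane the Gamma function is bounded by its real value. -/
theorem norm_Gamma_le {s : ℂ} (hs : 0 < s.re) : ‖Complex.Gamma s‖ ≤ Real.Gamma s.re := by
  rw [Complex.Gamma_eq_integral hs, Complex.GammaIntegral, Real.Gamma_eq_integral hs]
  refine (norm_integral_le_integral_norm _).trans_eq ?_
  refine setIntegral_congr_fun measurableSet_Ioi fun x hx => ?_
  have hx : 0 < x := hx
  simp only [norm_mul, Complex.norm_cpow_eq_rpow_re_of_pos hx, Complex.norm_real,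
    Complex.sub_re, Complex.one_re, Real.norm_eq_abs, Real.abs_exp]

/-- The functional equation `s Γ(s) = Γ(s+1)` gains one power of `|s|`, which is all the decay
needed later. -/
theorem norm_Gamma_le_div {s : ℂ} (hs : 0 < s.re) :
    ‖Complex.Gamma s‖ ≤ Real.Gamma (s.re + 1) / ‖s‖ := by
  have hs0 : s ≠ 0 := fun h => by simp [h] at hs
  rw [le_div_iff₀ (norm_pos_iff.mpr hs0), mul_comm, ← norm_mul, ← Complex.Gamma_add_one _ hs0]
  have : 0 < (s + 1).re := by simp; linarith
  simpa using norm_Gamma_le this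

theorem continuous_Gamma_line {a : ℝ} (ha : 0 < a) (ε : ℝ) :
    Continuous fun t : ℝ => Complex.Gamma (a + ((ε * t : ℝ) : ℂ) * Complex.I) := by
  rw [continuous_iff_continuousAt]
  intro t
  have hd : DifferentiableAt ℂ Complex.Gamma (a + ((ε * t : ℝ) : ℂ) * Complex.I) := by
    apply Complex.differentiableAt_Gamma
    intro m h
    have := congrArg Complex.re h
    simp at this
    have : (0 : ℝ) ≤ m := m.cast_nonneg
    linarith
  have := ContinuousAt.comp (f := fun t : ℝ => (a : ℂ) + ((ε * t : ℝ) : ℂ) * Complex.I)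
    (x := t) hd.continuousAt (by fun_prop)
  exact this

theorem integrable_inv_mul_norm_line {a c : ℝ} (ha : 0 < a) (hc : 0 < c) (ε : ℝ) (hε : ε ^ 2 = 1) :
    Integrable fun t : ℝ =>
      (‖(a : ℂ) + ((ε * t : ℝ) : ℂ) * Complex.I‖)⁻¹ * (‖(c : ℂ) + (t : ℂ) * Complex.I‖)⁻¹ := by
  -- With `m ≤ 1` and `m ≤ b`, both terms of `m²(1 + u²)` are dominated by those of `b² + u²`.
  have hm : 0 < min (min a c) 1 := by positivity
  set m := min (min a c) 1
  have hbound : ∀ b : ℝ, m ≤ b → ∀ u : ℝ,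
      m * Real.sqrt (1 + u ^ 2) ≤ ‖(b : ℂ) + (u : ℂ) * Complex.I‖ := by
    intro b hb u
    rw [Complex.norm_add_mul_I]
    apply Real.le_sqrt_of_sq_le
    rw [mul_pow, Real.sq_sqrt (by positivity)]
    have h1 : m ≤ 1 := min_le_right _ _
    have h2 : m ^ 2 ≤ 1 := by nlinarith
    have h3 : m ^ 2 ≤ b ^ 2 := by nlinarith
    nlinarith [sq_nonneg u]
  have hma : m ≤ a := (min_le_left _ _).trans (min_le_left _ _)
  have hmc : m ≤ c := (min_le_left _ _).trans (min_le_right _ _)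
  refine (integrable_inv_one_add_sq.const_mul (m⁻¹ * m⁻¹)).mono' ?_ (ae_of_all _ fun t => ?_)
  · apply Measurable.aestronglyMeasurable
    fun_prop
  · have h1 := hbound a hma (ε * t)
    have h2 := hbound c hmc t
    rw [mul_pow, hε, one_mul] at h1
    have hs : 0 < Real.sqrt (1 + t ^ 2) := by positivity
    rw [Real.norm_of_nonneg (by positivity)]
    calc _ ≤ (m * Real.sqrt (1 + t ^ 2))⁻¹ * (m * Real.sqrt (1 + t ^ 2))⁻¹ := by gcongr
      _ = m⁻¹ * m⁻¹ * (Real.sqrt (1 + t ^ 2) ^ 2)⁻¹ := by rw [mul_inv]; ring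
      _ = _ := by rw [Real.sq_sqrt (by positivity)]

theorem norm_Gamma_pow_line_le {a : ℝ} (ha : 0 < a) (ε t : ℝ) (k : ℕ) :
    ‖Complex.Gamma (a + ((ε * t : ℝ) : ℂ) * Complex.I) ^ k‖ ≤ Real.Gamma a ^ k := by
  rw [norm_pow]
  gcongr
  have := norm_Gamma_le (s := a + ((ε * t : ℝ) : ℂ) * Complex.I) (by simpa using ha)
  simpa using this

/-- One of the `k` Gamma factors supplies the decay `1/|t|`; the others are merely bounded. -/
theorem integrable_Gamma_pow_div_line {a c : ℝ} (ha : 0 < a) (hc : 0 < c) (ε : ℝ)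
    (hε : ε ^ 2 = 1) {k : ℕ} (hk : k ≠ 0) :
    Integrable fun t : ℝ => Complex.Gamma (a + ((ε * t : ℝ) : ℂ) * Complex.I) ^ k /
      ((c : ℂ) + (t : ℂ) * Complex.I) := by
  have hne : ∀ t : ℝ, (c : ℂ) + (t : ℂ) * Complex.I ≠ 0 := fun t h => by
    have := congrArg Complex.re h
    simp at this
    exact hc.ne' this
  have hcont : Continuous fun t : ℝ => Complex.Gamma (a + ((ε * t : ℝ) : ℂ) * Complex.I) ^ k /
      ((c : ℂ) + (t : ℂ) * Complex.I) :=
    ((continuous_Gamma_line ha ε).pow k).div (by fun_prop) hne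
  obtain ⟨l, rfl⟩ := Nat.exists_eq_succ_of_ne_zero hk
  refine ((integrable_inv_mul_norm_line ha hc ε hε).const_mul
    (Real.Gamma a ^ l * Real.Gamma (a + 1))).mono' hcont.aestronglyMeasurable
    (ae_of_all _ fun t => ?_)
  rw [norm_div, pow_succ, norm_mul]
  have h1 := norm_Gamma_pow_line_le ha ε t l
  have h2 := norm_Gamma_le_div (s := a + ((ε * t : ℝ) : ℂ) * Complex.I) (by simpa using ha)
  have h3 : (a + ((ε * t : ℝ) : ℂ) * Complex.I).re = a := by simp
  rw [h3] at h2
  have hG : 0 ≤ Real.Gamma a ^ l := by positivity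
  calc _ ≤ Real.Gamma a ^ l * (Real.Gamma (a + 1) / ‖(a : ℂ) + ((ε * t : ℝ) : ℂ) * Complex.I‖) /
        ‖(c : ℂ) + (t : ℂ) * Complex.I‖ := by gcongr
    _ = _ := by rw [div_eq_mul_inv, div_eq_mul_inv]; ring

theorem integrable_Gamma_mul_Gamma_div_line {M N : ℕ} (hMN : 1 ≤ M + N) {c : ℝ} (hc : 0 < c)
    (hcM : M ≠ 0 → c < 1 / 2) :
    Integrable fun t : ℝ => Complex.Gamma (1 / 2 - ((c : ℂ) + (t : ℂ) * Complex.I)) ^ M *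
      Complex.Gamma (1 / 2 + ((c : ℂ) + (t : ℂ) * Complex.I)) ^ N /
        ((c : ℂ) + (t : ℂ) * Complex.I) := by
  have e1 : ∀ t : ℝ, (1 / 2 - ((c : ℂ) + (t : ℂ) * Complex.I)) =
      ((1 / 2 - c : ℝ) : ℂ) + (((-1) * t : ℝ) : ℂ) * Complex.I := fun t => by push_cast; ring
  have e2 : ∀ t : ℝ, (1 / 2 + ((c : ℂ) + (t : ℂ) * Complex.I)) =
      ((1 / 2 + c : ℝ) : ℂ) + ((1 * t : ℝ) : ℂ) * Complex.I := fun t => by push_cast; ring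
  simp_rw [e1, e2]
  have hb : 0 < 1 / 2 + c := by linarith
  -- The decay comes from `Γ(1/2 + s)` if `M = 0`, and otherwise from `Γ(1/2 - s)`, the other factor
  -- being bounded.
  rcases Nat.eq_zero_or_pos M with rfl | hM
  · simp only [pow_zero]
    simp_rw [one_mul (Complex.Gamma _ ^ N)]
    exact integrable_Gamma_pow_div_line hb hc 1 (by norm_num) (k := N) (by omega)
  · have ha : 0 < 1 / 2 - c := by linarith [hcM hM.ne']
    have h1 := integrable_Gamma_pow_div_line (ε := -1) ha hc (by norm_num) hM.ne'
    have h2 := h1.bdd_mul (c := Real.Gamma (1 / 2 + c) ^ N)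
      (((continuous_Gamma_line hb 1).pow N).aestronglyMeasurable)
      (ae_of_all _ fun t => norm_Gamma_pow_line_le hb 1 t N)
    exact h2.congr (ae_of_all _ fun t => by simp only [Pi.pow_apply]; ring)

/-! ### Mellin transform of a tail function and its inversion -/

/-- The integral of `y ^ (s - 1)` over `(0, x]`, written as an integral over `(0, ∞)`. -/
theorem integral_Ioi_indicator_cpow {s : ℂ} (hs : 0 < s.re) {x : ℝ} (hx : 0 ≤ x) :
    ∫ y in Set.Ioi (0 : ℝ), (Set.Iic x).indicator (fun y : ℝ => (y : ℂ) ^ (s - 1)) y =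
      (x : ℂ) ^ s / s := by
  rw [setIntegral_indicator measurableSet_Iic, Set.Ioi_inter_Iic,
    ← intervalIntegral.integral_of_le hx,
    integral_cpow (Or.inl (by simpa using hs)), sub_add_cancel,
    Complex.ofReal_zero, Complex.zero_cpow (fun h => by simp [h] at hs), sub_zero]

theorem integrableOn_Ioi_indicator_cpow {s : ℂ} (hs : 0 < s.re) (x : ℝ) :
    IntegrableOn ((Set.Iic x).indicator (fun y : ℝ => (y : ℂ) ^ (s - 1))) (Set.Ioi 0) := by
  rw [integrableOn_indicator_iff measurableSet_Iic, Set.Iic_inter_Ioi]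
  rcases le_or_gt 0 x with hx | hx
  · exact (intervalIntegrable_iff_integrableOn_Ioc_of_le hx).mp
      (intervalIntegral.intervalIntegrable_cpow' (by simpa using hs))
  · simp [Set.Ioc_eq_empty_of_le hx.le]

theorem integral_indicator_eq_measureReal_Ici (ν : Measure ℝ) (y : ℝ) (s : ℂ) :
    ∫ x, (Set.Iic x).indicator (fun y : ℝ => (y : ℂ) ^ (s - 1)) y ∂ν =
      (y : ℂ) ^ (s - 1) • (ν.real (Set.Ici y) : ℂ) := by
  have : ∀ x, (Set.Iic x).indicator (fun y : ℝ => (y : ℂ) ^ (s - 1)) y =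
      (Set.Ici y).indicator (fun _ => (y : ℂ) ^ (s - 1)) x := fun x => by
    simp [Set.indicator_apply]
  simp_rw [this]
  rw [integral_indicator_const _ measurableSet_Ici, Complex.real_smul, smul_eq_mul, mul_comm]

section Tail

variable (ν : Measure ℝ) [IsProbabilityMeasure ν]

/-- Tonelli: since `|y^(s-1)| = y^(Re s - 1)`, integrating the norm in `y` leaves `x^(Re s) / Re s`,
which is `ν`-integrable. This licenses the Fubini swap for the Mellin transform. -/
theorem integrable_prod_indicator_cpow (hν : ∀ᵐ x ∂ν, 0 ≤ x) {s : ℂ} (hs : 0 < s.re)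
    (hint : Integrable (fun x : ℝ => x ^ s.re) ν) :
    Integrable (fun p : ℝ × ℝ => (Set.Iic p.2).indicator (fun y : ℝ => (y : ℂ) ^ (s - 1)) p.1)
      ((volume.restrict (Set.Ioi 0)).prod ν) := by
  have hmeas : Measurable fun p : ℝ × ℝ =>
      (Set.Iic p.2).indicator (fun y : ℝ => (y : ℂ) ^ (s - 1)) p.1 := by
    have : (fun p : ℝ × ℝ => (Set.Iic p.2).indicator (fun y : ℝ => (y : ℂ) ^ (s - 1)) p.1) =
        {p : ℝ × ℝ | p.1 ≤ p.2}.indicator (fun p => (p.1 : ℂ) ^ (s - 1)) := by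
      ext p
      simp [Set.indicator_apply]
    rw [this]
    exact Measurable.indicator (by fun_prop) (measurableSet_le measurable_fst measurable_snd)
  rw [integrable_prod_iff' hmeas.aestronglyMeasurable]
  refine ⟨ae_of_all _ fun x => integrableOn_Ioi_indicator_cpow hs x, ?_⟩
  refine (hint.div_const s.re).congr ?_
  filter_upwards [hν] with x hx
  have hs' : 0 < ((s.re : ℝ) : ℂ).re := by simpa using hs
  have h := integral_Ioi_indicator_cpow hs' hx
  have hcongr : ∫ y in Set.Ioi (0 : ℝ),
      (Set.Iic x).indicator (fun y : ℝ => (y : ℂ) ^ ((s.re : ℂ) - 1)) y =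
      ((∫ y in Set.Ioi (0 : ℝ),
        ‖(Set.Iic x).indicator (fun y : ℝ => (y : ℂ) ^ (s - 1)) y‖ : ℝ) : ℂ) := by
    rw [← integral_complex_ofReal]
    refine setIntegral_congr_fun measurableSet_Ioi fun y hy => ?_
    have hy : 0 < y := hy
    by_cases hyx : y ≤ x
    · simp only [Set.indicator_apply, Set.mem_Iic, hyx, if_true,
        Complex.norm_cpow_eq_rpow_re_of_pos hy, Complex.ofReal_cpow hy.le]
      simp
    · simp [hyx]
  rw [hcongr, ← Complex.ofReal_cpow hx, ← Complex.ofReal_div, Complex.ofReal_inj] at h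
  exact h.symm

theorem mellinConvergent_measureReal_Ici (hν : ∀ᵐ x ∂ν, 0 ≤ x) {s : ℂ} (hs : 0 < s.re)
    (hint : Integrable (fun x : ℝ => x ^ s.re) ν) :
    MellinConvergent (fun y => (ν.real (Set.Ici y) : ℂ)) s := by
  have := (integrable_prod_indicator_cpow ν hν hs hint).integral_prod_left
  simp_rw [integral_indicator_eq_measureReal_Ici] at this
  exact this

/-- The Mellin transform of the tail of a probability measure on `[0, ∞)`. -/
theorem mellin_measureReal_Ici (hν : ∀ᵐ x ∂ν, 0 ≤ x) {s : ℂ} (hs : 0 < s.re)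
    (hint : Integrable (fun x : ℝ => x ^ s.re) ν) :
    mellin (fun y => (ν.real (Set.Ici y) : ℂ)) s = (∫ x, (x : ℂ) ^ s ∂ν) / s := by
  have h := integral_integral_swap
    (f := fun y x : ℝ => (Set.Iic x).indicator (fun y : ℝ => (y : ℂ) ^ (s - 1)) y)
    (integrable_prod_indicator_cpow ν hν hs hint)
  simp_rw [integral_indicator_eq_measureReal_Ici] at h
  rw [mellin, h, ← integral_div]
  refine integral_congr_ae ?_
  filter_upwards [hν] with x hx
  exact integral_Ioi_indicator_cpow hs hx

/-- Dominated convergence: for `x ≠ y` the indicator of `u ≤ x` is locally constant in `u` near `y`.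
Pointwise Mellin inversion requires this continuity. -/
theorem continuousAt_measureReal_Ici {y : ℝ} (hy : ν {y} = 0) :
    ContinuousAt (fun y => (ν.real (Set.Ici y) : ℂ)) y := by
  have heq : (fun y => (ν.real (Set.Ici y) : ℂ)) =
      fun y => ∫ x, (Set.Ici y).indicator (fun _ => (1 : ℂ)) x ∂ν := by
    ext y
    rw [integral_indicator_const _ measurableSet_Ici]
    simp
  rw [heq]
  refine continuousAt_of_dominated (bound := fun _ => 1) ?_ ?_ (integrable_const _) ?_
  · exact Filter.Eventually.of_forall fun y =>
      (measurable_const.indicator measurableSet_Ici).aestronglyMeasurable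
  · refine Filter.Eventually.of_forall fun y => ae_of_all _ fun x => ?_
    refine (norm_indicator_le_norm_self _ _).trans (by simp)
  · have : ∀ᵐ x ∂ν, x ≠ y := by
      rw [ae_iff]
      simpa using hy
    filter_upwards [this] with x hx
    rcases lt_or_gt_of_ne hx with h | h
    · refine (continuousAt_const (y := (0 : ℂ))).congr ?_
      filter_upwards [lt_mem_nhds h] with u hu
      simp [not_le.mpr hu]
    · refine (continuousAt_const (y := (1 : ℂ))).congr ?_
      filter_upwards [gt_mem_nhds h] with u hu
      simp [hu.le]

/-- The tail of a probability measure on `[0, ∞)` as an inverse Mellin transform of its moments. -/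
theorem measureReal_Ici_eq_integral (hν : ∀ᵐ x ∂ν, 0 ≤ x) {c : ℝ} (hc : 0 < c)
    (hint : Integrable (fun x : ℝ => x ^ c) ν) {y : ℝ} (hy : 0 < y) (hatom : ν {y} = 0)
    (hvert : Integrable fun t : ℝ => (∫ x, (x : ℂ) ^ ((c : ℂ) + t * Complex.I) ∂ν) /
      ((c : ℂ) + t * Complex.I)) :
    (ν.real (Set.Ici y) : ℂ) = 1 / (2 * Real.pi : ℂ) * ∫ t : ℝ,
      (y : ℂ) ^ (-((c : ℂ) + t * Complex.I)) *
        ((∫ x, (x : ℂ) ^ ((c : ℂ) + t * Complex.I) ∂ν) / ((c : ℂ) + t * Complex.I)) := by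
  have hre : ∀ t : ℝ, ((c : ℂ) + t * Complex.I).re = c := fun t => by simp
  have hm : ∀ t : ℝ, mellin (fun y => (ν.real (Set.Ici y) : ℂ)) ((c : ℂ) + t * Complex.I) =
      (∫ x, (x : ℂ) ^ ((c : ℂ) + t * Complex.I) ∂ν) / ((c : ℂ) + t * Complex.I) := fun t =>
    mellin_measureReal_Ici ν hν (by rw [hre]; exact hc) (by rw [hre]; exact hint)
  have h := mellinInv_mellin_eq c (fun y => (ν.real (Set.Ici y) : ℂ)) hy
    (mellinConvergent_measureReal_Ici ν hν (by simpa using hc) (by simpa using hint))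
    (by simp_rw [Complex.VerticalIntegrable, hm]; exact hvert)
    (continuousAt_measureReal_Ici ν hatom)
  rw [← h, mellinInv]
  simp_rw [hm, smul_eq_mul, Complex.real_smul]
  push_cast
  rfl

end Tail

/-! ### Atoms and symmetry of products of independent variables -/

section Products

variable {Ω ι : Type*} [MeasurableSpace Ω] {P : Measure Ω} [IsProbabilityMeasure P] [Fintype ι]
  {W : ι → Ω → ℝ}

theorem map_fun_prod_eq_map_mul [DecidableEq ι] (hW : iIndepFun W P)
    (hm : ∀ k, AEMeasurable (W k) P) (k : ι) :
    P.map (fun ω => ∏ i, W i ω) =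
      ((P.map (∏ i ∈ Finset.univ.erase k, W i)).prod (P.map (W k))).map
        (fun p : ℝ × ℝ => p.1 * p.2) := by
  have hR : AEMeasurable (∏ i ∈ Finset.univ.erase k, W i) P :=
    Finset.aemeasurable_prod _ fun i _ => hm i
  have hind := hW.indepFun_finsetProd_of_notMem₀ hm (Finset.notMem_erase k Finset.univ)
  rw [← (indepFun_iff_map_prod_eq_prod_map_map hR (hm k)).mp hind,
    AEMeasurable.map_map_of_aemeasurable (by fun_prop) (hR.prodMk (hm k))]
  congr 1
  ext ω
  simp [Finset.prod_erase_mul]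

/-- A product of independent real random variables without atoms has no atoms. -/
theorem map_fun_prod_singleton_eq_zero [Nonempty ι] (hW : iIndepFun W P)
    (hm : ∀ k, AEMeasurable (W k) P) (hatom : ∀ k a, P.map (W k) {a} = 0) (a : ℝ) :
    P.map (fun ω => ∏ i, W i ω) {a} = 0 := by
  classical
  rcases eq_or_ne a 0 with rfl | ha
  · have hprod : AEMeasurable (fun ω => ∏ i, W i ω) P :=
      Finset.aemeasurable_fun_prod _ fun i _ => hm i
    rw [Measure.map_apply_of_aemeasurable hprod (measurableSet_singleton _)]
    have : (fun ω => ∏ i, W i ω) ⁻¹' {0} = ⋃ i, W i ⁻¹' {0} := by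
      ext ω
      simp [Finset.prod_eq_zero_iff]
    rw [this, measure_iUnion_null_iff]
    intro i
    rw [← Measure.map_apply_of_aemeasurable (hm i) (measurableSet_singleton _)]
    exact hatom i 0
  · obtain ⟨k⟩ := ‹Nonempty ι›
    have : IsProbabilityMeasure (P.map (W k)) := Measure.isProbabilityMeasure_map (hm k)
    have hmul : Measurable fun p : ℝ × ℝ => p.1 * p.2 := by fun_prop
    rw [map_fun_prod_eq_map_mul hW hm k, Measure.map_apply hmul (measurableSet_singleton _),
      Measure.measure_prod_null (hmul (measurableSet_singleton _))]
    -- For a fixed value `r` of the remaining product, `r * u = a` forces `u = a / r`; for `r = 0`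
    -- the slice is empty because `a ≠ 0`.
    refine ae_of_all _ fun r => measure_mono_null (t := {a / r}) ?_ (hatom k _)
    intro u hu
    have hu : r * u = a := hu
    have hr : r ≠ 0 := fun h => ha (by rw [← hu, h, zero_mul])
    rw [Set.mem_singleton_iff, eq_div_iff hr, mul_comm, hu]

/-- A product of independent real random variables, one of which is symmetric, is symmetric. -/
theorem map_neg_map_fun_prod (hW : iIndepFun W P) (hm : ∀ k, AEMeasurable (W k) P) (k : ι)
    (hsymm : (P.map (W k)).map (fun x => -x) = P.map (W k)) :
    (P.map (fun ω => ∏ i, W i ω)).map (fun x => -x) = P.map (fun ω => ∏ i, W i ω) := by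
  classical
  have hR : AEMeasurable (∏ i ∈ Finset.univ.erase k, W i) P :=
    Finset.aemeasurable_prod _ fun i _ => hm i
  have : IsProbabilityMeasure (P.map (W k)) := Measure.isProbabilityMeasure_map (hm k)
  have : IsProbabilityMeasure (P.map (∏ i ∈ Finset.univ.erase k, W i)) :=
    Measure.isProbabilityMeasure_map hR
  rw [map_fun_prod_eq_map_mul hW hm k, Measure.map_map (by fun_prop) (by fun_prop)]
  conv_rhs => rw [← hsymm]
  nth_rw 2 [← Measure.map_id (μ := P.map (∏ i ∈ Finset.univ.erase k, W i))]
  rw [Measure.map_prod_map _ _ measurable_id (by fun_prop),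
    Measure.map_map (by fun_prop) (by fun_prop)]
  congr 1
  ext p
  simp

end Products

/-! ### Distribution functions of symmetric atomless laws -/

section Symmetric

variable {μ : Measure ℝ} [IsProbabilityMeasure μ]

theorem measureReal_Iic_neg (hsymm : μ.map (fun x => -x) = μ) (hatom : ∀ a, μ {a} = 0) (z : ℝ) :
    μ.real (Set.Iic (-z)) = 1 - μ.real (Set.Iic z) := by
  have h1 : μ.real (Set.Iic (-z)) = μ.real (Set.Ici z) := by
    conv_lhs => rw [← hsymm]
    rw [map_measureReal_apply (by fun_prop) measurableSet_Iic]
    congr 1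
    ext x
    simp
  have : NullSingletonClass μ := ⟨hatom⟩
  rw [h1, measureReal_congr (Ioi_ae_eq_Ici (a := z)).symm, ← Set.compl_Iic,
    probReal_compl_eq_one_sub measurableSet_Iic]

/-- The distribution function of a symmetric law without atoms, in terms of the absolute value. -/
theorem measureReal_Iic_eq_of_symm (hsymm : μ.map (fun x => -x) = μ) (hatom : ∀ a, μ {a} = 0)
    (z : ℝ) :
    μ.real (Set.Iic z) = 1 / 2 + Real.sign z / 2 * μ.real {x | |x| ≤ |z|} := by
  have hpos : ∀ z : ℝ, 0 ≤ z → μ.real {x | |x| ≤ z} = 2 * μ.real (Set.Iic z) - 1 := by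
    intro z hz
    have : NullSingletonClass μ := ⟨hatom⟩
    have h1 : {x : ℝ | |x| ≤ z} = Set.Icc (-z) z := by
      ext x
      simp [abs_le]
    rw [h1, measureReal_congr (Ioc_ae_eq_Icc (a := -z) (b := z)).symm, ← Set.Iic_sdiff_Iic,
      measureReal_sdiff (Set.Iic_subset_Iic.mpr (by linarith)) measurableSet_Iic,
      measureReal_Iic_neg hsymm hatom]
    ring
  rw [hpos _ (abs_nonneg z)]
  rcases lt_trichotomy z 0 with hz | rfl | hz
  · have := measureReal_Iic_neg hsymm hatom z
    rw [Real.sign_of_neg hz, abs_of_neg hz, this]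
    ring
  · have := measureReal_Iic_neg hsymm hatom 0
    rw [neg_zero] at this
    rw [Real.sign_zero]
    linarith
  · rw [Real.sign_of_pos hz, abs_of_pos hz]
    ring

end Symmetric

/-! ### Complex powers of nonnegative reals -/

theorem prod_ofReal_cpow {ι : Type*} (t : Finset ι) {r : ι → ℝ} (hr : ∀ i, 0 ≤ r i) (s : ℂ) :
    ((∏ i ∈ t, r i : ℝ) : ℂ) ^ s = ∏ i ∈ t, (r i : ℂ) ^ s := by
  classical
  induction t using Finset.induction_on with
  | empty => simp
  | insert i t hi ih =>
    rw [Finset.prod_insert hi, Finset.prod_insert hi, Complex.ofReal_mul,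
      Complex.mul_cpow_ofReal_nonneg (hr i) (Finset.prod_nonneg fun j _ => hr j), ih]

theorem ofReal_inv_cpow {r : ℝ} (hr : 0 ≤ r) (s : ℂ) : ((r⁻¹ : ℝ) : ℂ) ^ s = (r : ℂ) ^ (-s) := by
  rw [Complex.ofReal_inv, Complex.inv_cpow, Complex.cpow_neg]
  rw [Complex.arg_ofReal_of_nonneg hr]
  exact Real.pi_pos.ne

/-! ### Meijer integrands and their separating lines -/

section Meijer

theorem meijerIntegrand_headThenConst_constThenLast (M N : ℕ) (u v u' v' : ℂ) (x : ℝ) (s : ℂ) :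
    meijerIntegrand M (N + 1) (headThenConst N u v) (constThenLast M v' u') x s =
      Complex.Gamma (v' - s) ^ M * (Complex.Gamma (1 - u + s) * Complex.Gamma (1 - v + s) ^ N) /
        Complex.Gamma (1 - u' + s) * (x : ℂ) ^ s := by
  simp [meijerIntegrand, headThenConst, constThenLast, Finset.prod_filter, Fin.prod_univ_castSucc,
    Fin.prod_univ_succ (n := N), not_le.mpr]

/-- In each family of poles the one with `k = 0` lies closest to the line, so it alone constrains
`c`. -/
theorem isMeijerLine_headThenConst_constThenLast {M N : ℕ} {u v u' v' : ℂ} {c : ℝ} :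
    IsMeijerLine M (N + 1) (headThenConst N u v) (constThenLast M v' u') c ↔
      (M ≠ 0 → c < v'.re) ∧ u.re - 1 < c ∧ (N ≠ 0 → v.re - 1 < c) := by
  constructor
  · rintro ⟨h1, h2⟩
    refine ⟨fun hM => ?_, ?_, fun hN => ?_⟩
    · have := h1 (Fin.castSucc ⟨0, Nat.pos_of_ne_zero hM⟩) (by simpa using Nat.pos_of_ne_zero hM) 0
      rw [constThenLast, Fin.snoc_castSucc] at this
      simpa using this
    · simpa [headThenConst] using h2 0 (by simp) 0
    · have := h2 (Fin.succ ⟨0, Nat.pos_of_ne_zero hN⟩) (by simpa using Nat.pos_of_ne_zero hN) 0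
      rw [headThenConst, Fin.cons_succ] at this
      simpa using this
  · rintro ⟨h1, h2, h3⟩
    refine ⟨fun j hj k => ?_, fun j hj k => ?_⟩
    · have hk : (0 : ℝ) ≤ k := k.cast_nonneg
      induction j using Fin.lastCases with
      | last => simp at hj
      | cast j =>
        rw [constThenLast, Fin.snoc_castSucc]
        have := h1 (by have := j.2; omega)
        simp
        linarith
    · have hk : (0 : ℝ) ≤ k := k.cast_nonneg
      induction j using Fin.cases with
      | zero =>
        simp [headThenConst]
        linarith
      | succ j =>
        have := h3 (by have := j.2; omega)
        simp [headThenConst]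
        linarith

/-- `meijerG` integrates over a line picked by choice; a value `A` shared by all separating lines
makes the choice immaterial. -/
theorem MeijerGWellDefined.of_forall_line {m n p q : ℕ} {a : Fin p → ℂ} {b : Fin q → ℂ} {x : ℝ}
    {A : ℂ} (hex : ∃ c, IsMeijerLine m n a b c)
    (h : ∀ c, IsMeijerLine m n a b c →
      Integrable (fun t : ℝ => meijerIntegrand m n a b x (c + t * Complex.I)) ∧
        meijerLineIntegral m n a b x c = A) :
    MeijerGWellDefined m n a b x ∧ meijerG m n a b x = A := by
  have hG : meijerG m n a b x = A := by
    rw [meijerG, dif_pos hex]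
    exact (h _ hex.choose_spec).2
  exact ⟨⟨hex, fun c hc => ⟨(h c hc).1, (h c hc).2.trans hG.symm⟩⟩, hG⟩

theorem meijerLineIntegral_eq (m n : ℕ) {p q : ℕ} (a : Fin p → ℂ) (b : Fin q → ℂ) (x c : ℝ) :
    meijerLineIntegral m n a b x c =
      1 / (2 * Real.pi : ℂ) * ∫ t : ℝ, meijerIntegrand m n a b x (c + t * Complex.I) := by
  rw [meijerLineIntegral, integral_mul_const]
  have : (Real.pi : ℂ) ≠ 0 := by exact_mod_cast Real.pi_ne_zero
  field_simp

/-- Shifting the parameters by `1 / 2` amounts to shifting the variable. -/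
theorem meijerIntegrand_shift (M N : ℕ) {x : ℝ} (hx : 0 < x) (s : ℂ) :
    meijerIntegrand M (N + 1) (headThenConst N (1 / 2) 0) (constThenLast M 0 (-1 / 2)) x s =
      (Real.sqrt x : ℂ)⁻¹ * meijerIntegrand M (N + 1) (headThenConst N 1 (1 / 2))
        (constThenLast M (1 / 2) 0) x (s + 1 / 2) := by
  rw [meijerIntegrand_headThenConst_constThenLast, meijerIntegrand_headThenConst_constThenLast]
  have hx0 : (x : ℂ) ≠ 0 := by exact_mod_cast hx.ne'
  have hsx : (Real.sqrt x : ℂ) ≠ 0 := by exact_mod_cast (Real.sqrt_pos.mpr hx).ne'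
  have h : (x : ℂ) ^ (1 / 2 : ℂ) = (Real.sqrt x : ℂ) := by
    rw [Real.sqrt_eq_rpow, Complex.ofReal_cpow hx.le]
    push_cast
    rfl
  rw [Complex.cpow_add _ _ hx0, h]
  have e1 : (1 / 2 : ℂ) - (s + 1 / 2) = 0 - s := by ring
  have e2 : (1 : ℂ) - 1 + (s + 1 / 2) = 1 - 1 / 2 + s := by ring
  have e3 : (1 : ℂ) - 1 / 2 + (s + 1 / 2) = 1 - 0 + s := by ring
  have e4 : (1 : ℂ) - 0 + (s + 1 / 2) = 1 - -1 / 2 + s := by ring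
  rw [e1, e2, e3, e4]
  field_simp

/-- The parameters `1` and `0` contribute `Γ(s)/Γ(s+1) = 1/s`, the factor found in the Mellin
transform of a tail. -/
theorem meijerIntegrand_eq_of_re_pos (M N : ℕ) (x : ℝ) {s : ℂ} (hs : 0 < s.re) :
    meijerIntegrand M (N + 1) (headThenConst N 1 (1 / 2)) (constThenLast M (1 / 2) 0) x s =
      Complex.Gamma (1 / 2 - s) ^ M * Complex.Gamma (1 / 2 + s) ^ N / s * (x : ℂ) ^ s := by
  rw [meijerIntegrand_headThenConst_constThenLast]
  have hs0 : s ≠ 0 := fun h => by simp [h] at hs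
  have hG := Complex.Gamma_ne_zero_of_re_pos hs
  have e1 : (1 : ℂ) - 1 + s = s := by ring
  have e2 : (1 : ℂ) - 1 / 2 + s = 1 / 2 + s := by ring
  have e3 : (1 : ℂ) - 0 + s = s + 1 := by ring
  rw [e1, e2, e3, Complex.Gamma_add_one _ hs0]
  field_simp

end Meijer

/-! ### Moments and law of the Gaussian quotient -/

section Quotient

variable {Ω : Type*} {M N : ℕ} {X : Fin M → Ω → ℝ} {Y : Fin N → Ω → ℝ}

/-- The factors `X_i` and `Y_j⁻¹` of the quotient `∏ X_i / ∏ Y_j`. -/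
noncomputable def quotientFactor (X : Fin M → Ω → ℝ) (Y : Fin N → Ω → ℝ) :
    Fin M ⊕ Fin N → Ω → ℝ :=
  Sum.elim X fun j ω => (Y j ω)⁻¹

theorem prod_quotientFactor (ω : Ω) :
    ∏ k, quotientFactor X Y k ω = (∏ i, X i ω) / ∏ j, Y j ω := by
  simp [quotientFactor, Fintype.prod_sum_type, div_eq_mul_inv]

variable [MeasurableSpace Ω] {P : Measure Ω} {σX : Fin M → ℝ} {σY : Fin N → ℝ}

theorem iIndepFun_quotientFactor (hindep : iIndepFun (Sum.elim X Y) P) :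
    iIndepFun (quotientFactor X Y) P := by
  let g : Fin M ⊕ Fin N → ℝ → ℝ := Sum.elim (fun _ x => x) fun _ x => x⁻¹
  have hg : ∀ k, Measurable (g k) := by
    rintro (i | j)
    · exact measurable_id
    · exact measurable_inv
  have := hindep.comp g hg
  convert! this using 1
  funext k
  rcases k with i | j <;> rfl

theorem aemeasurable_quotientFactor (hX : ∀ i, AEMeasurable (X i) P)
    (hY : ∀ j, AEMeasurable (Y j) P) (k : Fin M ⊕ Fin N) :
    AEMeasurable (quotientFactor X Y k) P := by
  rcases k with i | j
  · exact hX i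
  · exact (hY j).inv

theorem toNNReal_sq_ne_zero {σ : ℝ} (hσ : 0 < σ) : (σ ^ 2).toNNReal ≠ 0 := by
  simpa using hσ.ne'

theorem map_quotientFactor_singleton (hσX : ∀ i, 0 < σX i) (hσY : ∀ j, 0 < σY j)
    (hX : ∀ i, HasLaw (X i) (gaussianReal 0 (σX i ^ 2).toNNReal) P)
    (hY : ∀ j, HasLaw (Y j) (gaussianReal 0 (σY j ^ 2).toNNReal) P)
    (k : Fin M ⊕ Fin N) (a : ℝ) : P.map (quotientFactor X Y k) {a} = 0 := by
  rcases k with i | j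
  · change P.map (X i) {a} = 0
    have := nullSingletonClass_gaussianReal (μ := 0) (toNNReal_sq_ne_zero (hσX i))
    rw [(hX i).map_eq]
    exact measure_singleton a
  · have := nullSingletonClass_gaussianReal (μ := 0) (toNNReal_sq_ne_zero (hσY j))
    rw [Measure.map_apply_of_aemeasurable
      (aemeasurable_quotientFactor (fun i => (hX i).aemeasurable) (fun j => (hY j).aemeasurable) _)
      (measurableSet_singleton a)]
    -- Inversion is an involution of `ℝ` even at `0`, as `0⁻¹ = 0`, so `a = 0` needs no separate
    -- case.
    have hset : quotientFactor X Y (Sum.inr j) ⁻¹' {a} = Y j ⁻¹' {a⁻¹} := by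
      ext ω
      simp [quotientFactor, inv_eq_iff_eq_inv]
    rw [hset, ← Measure.map_apply_of_aemeasurable (hY j).aemeasurable (measurableSet_singleton _),
      (hY j).map_eq]
    exact measure_singleton _

theorem map_neg_map_quotientFactor
    (hX : ∀ i, HasLaw (X i) (gaussianReal 0 (σX i ^ 2).toNNReal) P)
    (hY : ∀ j, HasLaw (Y j) (gaussianReal 0 (σY j ^ 2).toNNReal) P) (k : Fin M ⊕ Fin N) :
    (P.map (quotientFactor X Y k)).map (fun x => -x) = P.map (quotientFactor X Y k) := by
  rcases k with i | j
  · change (P.map (X i)).map _ = P.map (X i)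
    rw [(hX i).map_eq, gaussianReal_map_neg, neg_zero]
  · have h : P.map (quotientFactor X Y (Sum.inr j)) =
        (gaussianReal 0 (σY j ^ 2).toNNReal).map (fun x => x⁻¹) := by
      rw [← (hY j).map_eq, AEMeasurable.map_map_of_aemeasurable (by fun_prop) (hY j).aemeasurable]
      rfl
    rw [h, Measure.map_map (by fun_prop) (by fun_prop)]
    nth_rw 2 [← neg_zero]
    rw [← gaussianReal_map_neg, Measure.map_map (by fun_prop) (by fun_prop)]
    congr 1
    ext x
    simp [inv_neg]

/-- The complex moments of `(∏ X_i / ∏ Y_j)⁻²`. -/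
theorem integral_inv_sq_cpow_quotient (hσX : ∀ i, 0 < σX i) (hσY : ∀ j, 0 < σY j)
    (hX : ∀ i, HasLaw (X i) (gaussianReal 0 (σX i ^ 2).toNNReal) P)
    (hY : ∀ j, HasLaw (Y j) (gaussianReal 0 (σY j ^ 2).toNNReal) P)
    (hindep : iIndepFun (Sum.elim X Y) P) {s : ℂ} (hs : 0 < s.re) (hsM : M ≠ 0 → s.re < 1 / 2) :
    ∫ ω, (((((∏ i, X i ω) / ∏ j, Y j ω) ^ 2)⁻¹ : ℝ) : ℂ) ^ s ∂P =
      ((2 ^ N * (∏ j, σY j) ^ 2 / (2 ^ M * (∏ i, σX i) ^ 2) : ℝ) : ℂ) ^ s *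
        (Complex.Gamma (1 / 2 - s) ^ M * Complex.Gamma (1 / 2 + s) ^ N) /
          (Real.sqrt Real.pi : ℂ) ^ (M + N) := by
  let f : ℝ → ℂ := fun x => (((x ^ 2)⁻¹ : ℝ) : ℂ) ^ s
  have hfm : Measurable f := by fun_prop
  have hpt : ∀ ω, (((((∏ i, X i ω) / ∏ j, Y j ω) ^ 2)⁻¹ : ℝ) : ℂ) ^ s =
      ∏ k, f (quotientFactor X Y k ω) := fun ω => by
    rw [← prod_quotientFactor, ← Finset.prod_pow, ← Finset.prod_inv_distrib,
      prod_ofReal_cpow _ fun k => by positivity]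
  simp_rw [hpt]
  rw [(iIndepFun_quotientFactor hindep).integral_fun_prod_comp (f := fun _ => f)
    (aemeasurable_quotientFactor (fun i => (hX i).aemeasurable) (fun j => (hY j).aemeasurable))
    (fun _ => hfm.aestronglyMeasurable), Fintype.prod_sum_type]
  have hfX : ∀ i, ∫ ω, f (quotientFactor X Y (Sum.inl i) ω) ∂P =
      (((2 * σX i ^ 2)⁻¹ : ℝ) : ℂ) ^ s * Complex.Gamma (1 / 2 - s) / (Real.sqrt Real.pi : ℂ) := by
    intro i
    have hM : M ≠ 0 := fun h => by subst h; exact i.elim0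
    have h1 := (hX i).integral_comp (f := f) hfm.aestronglyMeasurable
    have h2 := integral_sq_cpow_gaussianReal (hσX i) (w := -s)
      (by rw [Complex.neg_re]; linarith [hsM hM])
    rw [ofReal_inv_cpow (by positivity), sub_eq_add_neg, ← h2]
    refine h1.trans (integral_congr_ae (ae_of_all _ fun x => ?_))
    exact ofReal_inv_cpow (sq_nonneg x) s
  have hfY : ∀ j, ∫ ω, f (quotientFactor X Y (Sum.inr j) ω) ∂P =
      ((2 * σY j ^ 2 : ℝ) : ℂ) ^ s * Complex.Gamma (1 / 2 + s) / (Real.sqrt Real.pi : ℂ) := by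
    intro j
    have h2 := integral_sq_cpow_gaussianReal (hσY j) (w := s) (by linarith)
    rw [← h2, ← (hY j).integral_comp (f := fun x : ℝ => ((x ^ 2 : ℝ) : ℂ) ^ s)
      (by apply Measurable.aestronglyMeasurable; fun_prop)]
    refine integral_congr_ae (ae_of_all _ fun ω => ?_)
    simp [f, quotientFactor]
  simp_rw [hfX, hfY, Finset.prod_div_distrib, Finset.prod_mul_distrib]
  rw [← prod_ofReal_cpow _ (fun i => by positivity), ← prod_ofReal_cpow _ (fun i => by positivity)]
  have hκ : (2 ^ N * (∏ j, σY j) ^ 2 / (2 ^ M * (∏ i, σX i) ^ 2) : ℝ) =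
      (∏ i, (2 * σX i ^ 2)⁻¹) * ∏ j, (2 * σY j ^ 2) := by
    simp only [Finset.prod_inv_distrib, Finset.prod_mul_distrib, Finset.prod_pow,
      Finset.prod_const, Finset.card_univ, Fintype.card_fin]
    rw [div_eq_mul_inv, mul_comm]
  rw [hκ, Complex.ofReal_mul, Complex.mul_cpow_ofReal_nonneg
    (Finset.prod_nonneg fun i _ => by positivity) (Finset.prod_nonneg fun i _ => by positivity)]
  simp only [Finset.prod_const, Finset.card_univ, Fintype.card_fin, pow_add]
  ring

/-- The moment formula at the real exponent `c` has a nonzero right side, while the integral of a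
non-integrable function is `0` by convention; integrability follows. -/
theorem integrable_inv_sq_rpow_quotient (hσX : ∀ i, 0 < σX i) (hσY : ∀ j, 0 < σY j)
    (hX : ∀ i, HasLaw (X i) (gaussianReal 0 (σX i ^ 2).toNNReal) P)
    (hY : ∀ j, HasLaw (Y j) (gaussianReal 0 (σY j ^ 2).toNNReal) P)
    (hindep : iIndepFun (Sum.elim X Y) P) {c : ℝ} (hc : 0 < c) (hcM : M ≠ 0 → c < 1 / 2) :
    Integrable (fun ω => ((((∏ i, X i ω) / ∏ j, Y j ω) ^ 2)⁻¹ : ℝ) ^ c) P := by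
  have h := integral_inv_sq_cpow_quotient hσX hσY hX hY hindep (s := c) (by simpa using hc)
    (by simpa using hcM)
  have hκ : (0 : ℝ) < 2 ^ N * (∏ j, σY j) ^ 2 / (2 ^ M * (∏ i, σX i) ^ 2) := by
    have h1 : 0 < ∏ j, σY j := Finset.prod_pos fun j _ => hσY j
    have h2 : 0 < ∏ i, σX i := Finset.prod_pos fun i _ => hσX i
    positivity
  have hpi : (Real.sqrt Real.pi : ℂ) ≠ 0 := by
    exact_mod_cast (Real.sqrt_pos.mpr Real.pi_pos).ne'
  have h12 : ((1 : ℂ) / 2).re = 1 / 2 := by norm_num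
  have hne : ∫ ω, (((((∏ i, X i ω) / ∏ j, Y j ω) ^ 2)⁻¹ : ℝ) : ℂ) ^ (c : ℂ) ∂P ≠ 0 := by
    rw [h]
    refine div_ne_zero (mul_ne_zero ?_ (mul_ne_zero ?_ ?_)) (pow_ne_zero _ hpi)
    · rw [← Complex.ofReal_cpow hκ.le]
      exact_mod_cast (Real.rpow_pos_of_pos hκ c).ne'
    · rcases eq_or_ne M 0 with hM | hM
      · simp [hM]
      · refine pow_ne_zero _ (Complex.Gamma_ne_zero_of_re_pos ?_)
        rw [Complex.sub_re, h12, Complex.ofReal_re]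
        linarith [hcM hM]
    · refine pow_ne_zero _ (Complex.Gamma_ne_zero_of_re_pos ?_)
      rw [Complex.add_re, h12, Complex.ofReal_re]
      linarith
  have hint := (Integrable.of_integral_ne_zero hne).re
  refine hint.congr (ae_of_all _ fun ω => ?_)
  simp only
  rw [← Complex.ofReal_cpow (by positivity)]
  rfl

variable [IsProbabilityMeasure P]

/-- The law of `|∏ X_i / ∏ Y_j|` as a contour integral. -/
theorem measureReal_abs_quotient_le (hMN : 1 ≤ M + N) (hσX : ∀ i, 0 < σX i) (hσY : ∀ j, 0 < σY j)
    (hX : ∀ i, HasLaw (X i) (gaussianReal 0 (σX i ^ 2).toNNReal) P)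
    (hY : ∀ j, HasLaw (Y j) (gaussianReal 0 (σY j ^ 2).toNNReal) P)
    (hindep : iIndepFun (Sum.elim X Y) P)
    (hatom : ∀ a, P.map (fun ω => (∏ i, X i ω) / ∏ j, Y j ω) {a} = 0)
    {c : ℝ} (hc : 0 < c) (hcM : M ≠ 0 → c < 1 / 2) {z : ℝ} (hz : z ≠ 0) :
    Integrable (fun t : ℝ => meijerIntegrand M (N + 1) (headThenConst N 1 (1 / 2))
        (constThenLast M (1 / 2) 0)
        (2 ^ N * (∏ j, σY j) ^ 2 / (2 ^ M * (∏ i, σX i) ^ 2) * z ^ 2) (c + t * Complex.I)) ∧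
      meijerLineIntegral M (N + 1) (headThenConst N 1 (1 / 2)) (constThenLast M (1 / 2) 0)
        (2 ^ N * (∏ j, σY j) ^ 2 / (2 ^ M * (∏ i, σX i) ^ 2) * z ^ 2) c =
      (Real.sqrt Real.pi : ℂ) ^ (M + N) *
        ((P.map fun ω => (∏ i, X i ω) / ∏ j, Y j ω).real {x | |x| ≤ |z|} : ℂ) := by
  set κ : ℝ := 2 ^ N * (∏ j, σY j) ^ 2 / (2 ^ M * (∏ i, σX i) ^ 2) with hκdef
  have hκ : 0 < κ := by
    have h1 : 0 < ∏ j, σY j := Finset.prod_pos fun j _ => hσY j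
    have h2 : 0 < ∏ i, σX i := Finset.prod_pos fun i _ => hσX i
    positivity
  have hz2 : 0 < z ^ 2 := by positivity
  have hpi : (Real.sqrt Real.pi : ℂ) ^ (M + N) ≠ 0 :=
    pow_ne_zero _ (by exact_mod_cast (Real.sqrt_pos.mpr Real.pi_pos).ne')
  have hre : ∀ t : ℝ, ((c : ℂ) + t * Complex.I).re = c := fun t => by simp
  have hG := integrable_Gamma_mul_Gamma_div_line hMN hc hcM
  have hpow : ∀ {r : ℝ}, 0 < r → Continuous fun t : ℝ => (r : ℂ) ^ ((c : ℂ) + t * Complex.I) :=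
    fun {r} hr => Continuous.const_cpow (by fun_prop) (Or.inl (by exact_mod_cast hr.ne'))
  have hpowint : ∀ {r : ℝ}, 0 < r → Integrable fun t : ℝ =>
      (r : ℂ) ^ ((c : ℂ) + t * Complex.I) *
        (Complex.Gamma (1 / 2 - ((c : ℂ) + (t : ℂ) * Complex.I)) ^ M *
          Complex.Gamma (1 / 2 + ((c : ℂ) + (t : ℂ) * Complex.I)) ^ N /
            ((c : ℂ) + (t : ℂ) * Complex.I)) := fun {r} hr =>
    hG.bdd_mul (c := r ^ c) (hpow hr).aestronglyMeasurable (ae_of_all _ fun t => by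
      rw [Complex.norm_cpow_eq_rpow_re_of_pos hr, hre])
  have hZm : AEMeasurable (fun ω => (∏ i, X i ω) / ∏ j, Y j ω) P :=
    (Finset.aemeasurable_fun_prod _ fun i _ => (hX i).aemeasurable).div
      (Finset.aemeasurable_fun_prod _ fun j _ => (hY j).aemeasurable)
  set μ := P.map (fun ω => (∏ i, X i ω) / ∏ j, Y j ω) with hμ
  have : IsProbabilityMeasure μ := Measure.isProbabilityMeasure_map hZm
  have hinv : Measurable fun x : ℝ => (x ^ 2)⁻¹ := by fun_prop
  let ν := μ.map fun x => (x ^ 2)⁻¹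
  have : IsProbabilityMeasure ν := Measure.isProbabilityMeasure_map hinv.aemeasurable
  have hmom : ∀ t : ℝ, ∫ x, (x : ℂ) ^ ((c : ℂ) + t * Complex.I) ∂ν =
      (κ : ℂ) ^ ((c : ℂ) + t * Complex.I) *
        (Complex.Gamma (1 / 2 - ((c : ℂ) + t * Complex.I)) ^ M *
          Complex.Gamma (1 / 2 + ((c : ℂ) + t * Complex.I)) ^ N) /
            (Real.sqrt Real.pi : ℂ) ^ (M + N) := fun t => by
    rw [← integral_inv_sq_cpow_quotient hσX hσY hX hY hindep (by rw [hre]; exact hc)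
      (by rw [hre]; exact hcM), integral_map hinv.aemeasurable
        (by apply Measurable.aestronglyMeasurable; fun_prop), hμ, integral_map hZm
        (by apply Measurable.aestronglyMeasurable; fun_prop)]
  have hnn : ∀ᵐ x ∂ν, 0 ≤ x := by
    rw [ae_map_iff hinv.aemeasurable measurableSet_Ici]
    exact ae_of_all _ fun x => by positivity
  have hint : Integrable (fun x : ℝ => x ^ c) ν := by
    rw [integrable_map_measure (by apply Measurable.aestronglyMeasurable; fun_prop)
      hinv.aemeasurable, hμ, integrable_map_measure
        (by apply Measurable.aestronglyMeasurable; fun_prop) hZm]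
    exact integrable_inv_sq_rpow_quotient hσX hσY hX hY hindep hc hcM
  have hνatom : ν {(z ^ 2)⁻¹} = 0 := by
    rw [Measure.map_apply hinv (measurableSet_singleton _)]
    refine measure_mono_null (t := {z} ∪ {-z}) (fun x hx => ?_)
      (measure_union_null (hatom z) (hatom (-z)))
    have hx : (x ^ 2)⁻¹ = (z ^ 2)⁻¹ := hx
    exact sq_eq_sq_iff_eq_or_eq_neg.mp (inv_injective hx)
  have htail : ν.real (Set.Ici (z ^ 2)⁻¹) = μ.real {x | |x| ≤ |z|} := by
    rw [map_measureReal_apply hinv measurableSet_Ici]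
    refine measureReal_congr ?_
    -- At `x = 0` the convention `0⁻¹ = 0` makes the two events differ, so this null point is
    -- removed.
    have h0 : ∀ᵐ x ∂μ, x ≠ 0 := by
      rw [ae_iff]
      simpa using hatom 0
    filter_upwards [h0] with x hx
    have hx2 : 0 < x ^ 2 := by positivity
    apply propext
    change (z ^ 2)⁻¹ ≤ (x ^ 2)⁻¹ ↔ |x| ≤ |z|
    rw [inv_le_inv₀ hz2 hx2, sq_le_sq]
  have hintegrand : ∀ t : ℝ, meijerIntegrand M (N + 1) (headThenConst N 1 (1 / 2))
      (constThenLast M (1 / 2) 0) (κ * z ^ 2) (c + t * Complex.I) =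
      ((κ * z ^ 2 : ℝ) : ℂ) ^ ((c : ℂ) + t * Complex.I) *
        (Complex.Gamma (1 / 2 - ((c : ℂ) + (t : ℂ) * Complex.I)) ^ M *
          Complex.Gamma (1 / 2 + ((c : ℂ) + (t : ℂ) * Complex.I)) ^ N /
            ((c : ℂ) + (t : ℂ) * Complex.I)) := fun t => by
    rw [meijerIntegrand_eq_of_re_pos M N _ (by rw [hre]; exact hc), mul_comm]
  refine ⟨?_, ?_⟩
  · simp_rw [hintegrand]
    exact hpowint (by positivity)
  -- Inversion at `y = z⁻²` produces `y^(-s) = (z²)^s`, which merges with `κ^s` into `(κ z²)^s`.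
  · have hmain := measureReal_Ici_eq_integral ν hnn hc hint (inv_pos.mpr hz2) hνatom (by
      simp_rw [hmom]
      refine ((hpowint hκ).div_const ((Real.sqrt Real.pi : ℂ) ^ (M + N))).congr
        (ae_of_all _ fun t => ?_)
      ring)
    rw [meijerLineIntegral_eq, ← htail, hmain, mul_left_comm,
      ← integral_const_mul ((Real.sqrt Real.pi : ℂ) ^ (M + N))]
    congr 1
    refine integral_congr_ae (ae_of_all _ fun t => ?_)
    simp only
    rw [hintegrand, hmom, ofReal_inv_cpow hz2.le, neg_neg, Complex.ofReal_mul,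
      Complex.mul_cpow_ofReal_nonneg hκ.le hz2.le]
    field_simp

end Quotient

/-! ### Normalizing constants and the distribution function -/

theorem rpow_half_eq_sqrt_pow {r : ℝ} (hr : 0 ≤ r) (n : ℕ) :
    r ^ ((n : ℝ) / 2) = Real.sqrt r ^ n := by
  rw [Real.sqrt_eq_rpow, ← Real.rpow_natCast, ← Real.rpow_mul hr]
  ring_nf

/-- The two normalizing constants agree. -/
theorem normalizing_constant_eq (M N : ℕ) {σ s : ℝ} (hσ : 0 < σ) (hs : 0 < s) (z : ℝ) :
    (2 : ℝ) ^ (((N : ℝ) - M - 2) / 2) * s / (Real.pi ^ (((M : ℝ) + N) / 2) * σ) * z *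
        (Real.sqrt (2 ^ N * s ^ 2 / (2 ^ M * σ ^ 2) * z ^ 2))⁻¹ =
      Real.sign z / (2 * Real.pi ^ (((M : ℝ) + N) / 2)) := by
  rcases eq_or_ne z 0 with rfl | hz
  · simp
  have h2 : (0 : ℝ) < Real.sqrt 2 := by positivity
  have hsqrt : Real.sqrt (2 ^ N * s ^ 2 / (2 ^ M * σ ^ 2) * z ^ 2) =
      Real.sqrt 2 ^ N * s / (Real.sqrt 2 ^ M * σ) * |z| := by
    rw [← Real.sqrt_sq (x := Real.sqrt 2 ^ N * s / (Real.sqrt 2 ^ M * σ) * |z|) (by positivity)]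
    congr 1
    rw [mul_pow, div_pow, mul_pow, mul_pow, sq_abs, ← pow_mul, ← pow_mul, mul_comm N, mul_comm M,
      pow_mul, pow_mul, Real.sq_sqrt (by norm_num)]
  have hpow : (2 : ℝ) ^ (((N : ℝ) - M - 2) / 2) = Real.sqrt 2 ^ N / Real.sqrt 2 ^ M / 2 := by
    rw [show ((N : ℝ) - M - 2) / 2 = (N : ℝ) / 2 - (M : ℝ) / 2 - 1 by ring,
      Real.rpow_sub two_pos, Real.rpow_sub two_pos, Real.rpow_one,
      rpow_half_eq_sqrt_pow two_pos.le, rpow_half_eq_sqrt_pow two_pos.le]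
  have hsign : z * |z|⁻¹ = Real.sign z := by
    rcases lt_or_gt_of_ne hz with h | h
    · rw [Real.sign_of_neg h, abs_of_neg h]
      field_simp
    · rw [Real.sign_of_pos h, abs_of_pos h]
      field_simp
  have hpi : (0 : ℝ) < Real.pi ^ (((M : ℝ) + N) / 2) := Real.rpow_pos_of_pos Real.pi_pos _
  have habs : (0 : ℝ) < |z| := abs_pos.mpr hz
  rw [hsqrt, hpow, ← hsign]
  field_simp

theorem theorem2p2 {Ω : Type*} [MeasurableSpace Ω] (P : Measure Ω) [IsProbabilityMeasure P]
    (M N : ℕ) (hMN : 1 ≤ M + N)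
    (X : Fin M → Ω → ℝ) (Y : Fin N → Ω → ℝ)
    (σX : Fin M → ℝ) (σY : Fin N → ℝ) (hσX : ∀ i, 0 < σX i) (hσY : ∀ j, 0 < σY j)
    (hX : ∀ i, HasLaw (X i) (gaussianReal 0 (σX i ^ 2).toNNReal) P)
    (hY : ∀ j, HasLaw (Y j) (gaussianReal 0 (σY j ^ 2).toNNReal) P)
    (hindep : iIndepFun (Sum.elim X Y) P)
    (Z : Ω → ℝ) (hZ : ∀ ω, Z ω = (∏ i, X i ω) / ∏ j, Y j ω)
    (σ s κ : ℝ) (hσ : σ = ∏ i, σX i) (hs : s = ∏ j, σY j)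
    (hκ : κ = 2 ^ N * s ^ 2 / (2 ^ M * σ ^ 2)) (z : ℝ) :
    (P.real {ω | Z ω ≤ z} : ℂ) =
        1 / 2 + (((2 : ℝ) ^ (((N : ℝ) - M - 2) / 2) * s /
            (Real.pi ^ (((M : ℝ) + N) / 2) * σ) * z : ℝ) : ℂ) *
          meijerG M (N + 1) (headThenConst N (1 / 2) 0) (constThenLast M 0 (-1 / 2)) (κ * z ^ 2) ∧
    (P.real {ω | Z ω ≤ z} : ℂ) =
        1 / 2 + ((Real.sign z / (2 * Real.pi ^ (((M : ℝ) + N) / 2)) : ℝ) : ℂ) *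
          meijerG M (N + 1) (headThenConst N 1 (1 / 2)) (constThenLast M (1 / 2) 0) (κ * z ^ 2) ∧
    (z ≠ 0 →
      MeijerGWellDefined M (N + 1) (headThenConst N (1 / 2) 0) (constThenLast M 0 (-1 / 2))
          (κ * z ^ 2) ∧
        MeijerGWellDefined M (N + 1) (headThenConst N 1 (1 / 2)) (constThenLast M (1 / 2) 0)
          (κ * z ^ 2)) := by
  obtain rfl : Z = fun ω => (∏ i, X i ω) / ∏ j, Y j ω := funext hZ
  have hσpos : 0 < σ := hσ ▸ Finset.prod_pos fun i _ => hσX i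
  have hspos : 0 < s := hs ▸ Finset.prod_pos fun j _ => hσY j
  have hκpos : 0 < κ := by rw [hκ]; positivity
  have hZm : AEMeasurable (fun ω => (∏ i, X i ω) / ∏ j, Y j ω) P :=
    (Finset.aemeasurable_fun_prod _ fun i _ => (hX i).aemeasurable).div
      (Finset.aemeasurable_fun_prod _ fun j _ => (hY j).aemeasurable)
  have hW := iIndepFun_quotientFactor hindep
  have hWm := aemeasurable_quotientFactor (fun i => (hX i).aemeasurable)
    (fun j => (hY j).aemeasurable)
  have hne : Nonempty (Fin M ⊕ Fin N) := by
    rw [← Fintype.card_pos_iff]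
    rw [Fintype.card_sum, Fintype.card_fin, Fintype.card_fin]
    exact hMN
  have hatom : ∀ a, P.map (fun ω => (∏ i, X i ω) / ∏ j, Y j ω) {a} = 0 := fun a => by
    simp_rw [← prod_quotientFactor]
    exact map_fun_prod_singleton_eq_zero hW hWm (map_quotientFactor_singleton hσX hσY hX hY) a
  have hsymm : (P.map fun ω => (∏ i, X i ω) / ∏ j, Y j ω).map (fun x => -x) =
      P.map fun ω => (∏ i, X i ω) / ∏ j, Y j ω := by
    simp_rw [← prod_quotientFactor]
    obtain ⟨k⟩ := hne
    exact map_neg_map_fun_prod hW hWm k (map_neg_map_quotientFactor hX hY k)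
  have : IsProbabilityMeasure (P.map fun ω => (∏ i, X i ω) / ∏ j, Y j ω) :=
    Measure.isProbabilityMeasure_map hZm
  have hF : P.real {ω | (∏ i, X i ω) / ∏ j, Y j ω ≤ z} = 1 / 2 + Real.sign z / 2 *
      (P.map fun ω => (∏ i, X i ω) / ∏ j, Y j ω).real {x | |x| ≤ |z|} := by
    rw [← measureReal_Iic_eq_of_symm hsymm hatom z,
      map_measureReal_apply_of_aemeasurable hZm measurableSet_Iic]
    rfl
  rcases eq_or_ne z 0 with rfl | hz
  -- Both prefactors vanish at `z = 0`, so the value of `meijerG` at `0` plays no role.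
  · simp [hF]
  have hx : 0 < κ * z ^ 2 := by positivity
  have hline : ∀ c, IsMeijerLine M (N + 1) (headThenConst N 1 (1 / 2))
      (constThenLast M (1 / 2) 0) c ↔ (M ≠ 0 → c < 1 / 2) ∧ 0 < c := fun c => by
    rw [isMeijerLine_headThenConst_constThenLast]
    norm_num
    exact fun _ h _ => by linarith
  have hline' : ∀ c, IsMeijerLine M (N + 1) (headThenConst N (1 / 2) 0)
      (constThenLast M 0 (-1 / 2)) c → IsMeijerLine M (N + 1) (headThenConst N 1 (1 / 2))
        (constThenLast M (1 / 2) 0) (c + 1 / 2) := fun c hc => by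
    rw [isMeijerLine_headThenConst_constThenLast] at hc
    rw [hline]
    norm_num at hc ⊢
    exact ⟨hc.1, by linarith [hc.2.1]⟩
  have hval := fun c (hc : IsMeijerLine M (N + 1) (headThenConst N 1 (1 / 2))
      (constThenLast M (1 / 2) 0) c) =>
    measureReal_abs_quotient_le hMN hσX hσY hX hY hindep hatom ((hline c).mp hc).2
      ((hline c).mp hc).1 hz
  rw [← hσ, ← hs, ← hκ] at hval
  -- `1/4` lies in the strip `0 < Re s < 1/2`; below, `-1/4` is its translate by `-1/2`.
  obtain ⟨hwd, hG⟩ := MeijerGWellDefined.of_forall_line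
    ⟨1 / 4, (hline _).mpr ⟨fun _ => by norm_num, by norm_num⟩⟩ hval
  have hshift : ∀ c t : ℝ, meijerIntegrand M (N + 1) (headThenConst N (1 / 2) 0)
      (constThenLast M 0 (-1 / 2)) (κ * z ^ 2) (c + t * Complex.I) =
      (Real.sqrt (κ * z ^ 2) : ℂ)⁻¹ * meijerIntegrand M (N + 1) (headThenConst N 1 (1 / 2))
        (constThenLast M (1 / 2) 0) (κ * z ^ 2) (((c + 1 / 2 : ℝ) : ℂ) + t * Complex.I) :=
    fun c t => by
      rw [meijerIntegrand_shift M N hx]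
      congr 2
      push_cast
      ring
  -- Moving the line from `c` to `c + 1/2` reduces both convergence and value to the second
  -- `G`-function, at the cost of the factor `(κ z²)^(-1/2)`.
  obtain ⟨hwd', hG'⟩ := MeijerGWellDefined.of_forall_line
    (m := M) (n := N + 1) (a := headThenConst N (1 / 2) 0) (b := constThenLast M 0 (-1 / 2))
    (x := κ * z ^ 2) (A := (Real.sqrt (κ * z ^ 2) : ℂ)⁻¹ * meijerG M (N + 1)
      (headThenConst N 1 (1 / 2)) (constThenLast M (1 / 2) 0) (κ * z ^ 2))
    ⟨-1 / 4, isMeijerLine_headThenConst_constThenLast.mpr (by norm_num)⟩ fun c hc => by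
      have h := hwd.2 _ (hline' c hc)
      refine ⟨?_, ?_⟩
      · simp_rw [hshift]
        exact h.1.const_mul _
      · rw [← h.2, meijerLineIntegral_eq, meijerLineIntegral_eq]
        simp_rw [hshift]
        rw [integral_const_mul]
        ring
  have hF2 : (P.real {ω | (∏ i, X i ω) / ∏ j, Y j ω ≤ z} : ℂ) =
      1 / 2 + ((Real.sign z / (2 * Real.pi ^ (((M : ℝ) + N) / 2)) : ℝ) : ℂ) *
        meijerG M (N + 1) (headThenConst N 1 (1 / 2)) (constThenLast M (1 / 2) 0)
          (κ * z ^ 2) := by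
    have hpi : (Real.sqrt Real.pi : ℂ) ^ (M + N) ≠ 0 :=
      pow_ne_zero _ (by exact_mod_cast (Real.sqrt_pos.mpr Real.pi_pos).ne')
    have hpow : Real.pi ^ (((M : ℝ) + N) / 2) = Real.sqrt Real.pi ^ (M + N) := by
      rw [← rpow_half_eq_sqrt_pow Real.pi_pos.le]
      push_cast
      rfl
    rw [hG, hF, hpow]
    push_cast
    field_simp
  refine ⟨?_, hF2, fun _ => ⟨hwd', hwd⟩⟩
  rw [hF2, hG', ← normalizing_constant_eq M N hσpos hspos, ← hκ]
  push_cast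
  ring
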